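/- Let $L\ge 1$, $\mathcal L=\{0,1,\dots,L\}$, let $\mathcal X$ be a measurable space, and let $\mathcal G$ be a family of measurable classifiers $g:\mathcal X\to\mathcal L$. Let $\mathcal P_{\mathrm{sep}}$ be the set of all tuples $\mathbf P=(P_0,\dots,P_L)$ of probability measures on $\mathcal X$ for which there is $g\in\mathcal G$ with $P_\theta(g=\theta)>\max_{m\ne\theta}P_\theta(g=m)$ for every $\theta\in\mathcal L$. For $N\ge 0$, let $\mathbb P_{\mathbf P,\theta}$ be the joint law of the offline data $\mathbf T=(T_{\vartheta,i})_{\vartheta\in\mathcal L,\,1\le i\le N}$ and the test stream $(X_t)_{t\ge 1}$, all independent, with $T_{\vartheta,i}\sim P_\vartheta$ and $X_t\sim P_\theta$. A classifier-based test $\pi=(\phi,\tau)$ consists of a learning policy $\phi$, which maps $\mathbf T$ to a classifier $g=\phi(\mathbf T)\in\mathcal G$ (with $(\mathbf T,x)\mapsto\phi(\mathbf T)(x)$ measurable), and a stopping time $\tau$ with values in $\{0,1,2,\dots\}\cup\{\infty\}$ with respect to the filtration $\tilde{\mathcal F}_t=\sigma(\mathbf T,g(X_1),\dots,g(X_t))$,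 $t\ge 0$. Under $\pi$, write $\mathbb P^\pi_{\mathbf P,\theta}$ for $\mathbb P_{\mathbf P,\theta}$. For $\alpha\in(0,1)$ let $\Pi_\alpha(\mathcal P_{\mathrm{sep}})$ be the set of all classifier-based tests $\pi$ with $\sup_{\mathbf P\in\mathcal P_{\mathrm{sep}}}\mathbb P^\pi_{\mathbf P,0}(\tau<\infty)\le\alpha$ and $\inf_{\mathbf P\in\mathcal P_{\mathrm{sep}}}\mathbb P^\pi_{\mathbf P,\theta}(\tau<\infty)=1$ for all $\theta\in\mathcal L\setminus\{0\}$. Let $D(\cdot\|\cdot)$ denote the Kullback–Leibler divergence, with values in $[0,\infty]$. For an alternative $\theta\in\mathcal L\setminus\{0\}$, a tuple $\mathbf P$ and $g\in\mathcal G$ let $p^g_m$ be the law of $g(X)$ for $X\sim P_m$, and put $$D^*(\mathbf P)=\sup_{g\in\mathcal G}D(p^g_0\|p^g_\theta),\qquad \mathcal R(g,\mathbf P)=D^*(\mathbf P)-D(p^g_0\|p^g_\theta)\ge 0$$ (with $\infty-\infty=0$). **Theorem (minimax lower bound).** Let $\mathbf P_\nu=(P_{0,\nu},\dots,P_{L,\nu})$,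 $\nu\in\mathbb R$, be a parametrized family of tuples of probability measures on $\mathcal X$, and let $\nu_1=\nu_0+\delta$ for some $\delta>0$, where $\mathbf P_{\nu_0},\mathbf P_{\nu_1}\in\mathcal P_{\mathrm{sep}}$. Suppose that there is a finite $M>0$ with $D(P_{i,\nu_0}\|P_{i,\nu_1})\le M\delta^2$ for all $i\in\mathcal L$. Let $\theta\in\mathcal L\setminus\{0\}$, and suppose that there is a finite $B>0$ with $$\inf_{g\in\mathcal G}\bigl(\mathcal R(g,\mathbf P_{\nu_0})+\mathcal R(g,\mathbf P_{\nu_1})\bigr)>B$$ (classifier-capacity condition). Then, for every $\alpha\in(0,1)$, every training size $N\ge 0$ and every $n\ge 0$, $$\log\inf_{\pi\in\Pi_\alpha(\mathcal P_{\mathrm{sep}})}\ \sup_{\mathbf P\in\mathcal P_{\mathrm{sep}}}\mathbb P^\pi_{\mathbf P,\theta}(\tau>n)\ \ge\ -\frac{1}{1-\alpha}\left(n\Bigl(\max_{\nu\in\{\nu_0,\nu_1\}}D(P_{0,\nu}\|P_{\theta,\nu})-\frac B4\,e^{-NM(L+1)\delta^2}\Bigr)+\log 2\right).$$ (Both sides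 are taken in $[-\infty,\infty]$, with $\inf\emptyset=\infty$, $\log\infty=\infty$ and $0\cdot\infty=0$.) -/

import Mathlib

open MeasureTheory
open scoped ENNReal

namespace SeqTest

noncomputable section

/-- A tuple `(P_0, …, P_L)` of data-generating distributions on the alphabet `𝓧`. -/
abbrev Tuple (𝓧 : Type*) [MeasurableSpace 𝓧] (L : ℕ) : Type _ :=
  Fin (L + 1) → ProbabilityMeasure 𝓧

/-- Offline data: `T ϑ i` is the `i`-th of the `N` training samples drawn from `P_ϑ`. -/
abbrev Train (𝓧 : Type*) (L N : ℕ) : Type _ :=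
  Fin (L + 1) → Fin N → 𝓧

/-- Sample space: the offline data together with the test stream.
The observation `X_{s+1}` is the coordinate `ω.2 s`. -/
abbrev Sample (𝓧 : Type*) (L N : ℕ) : Type _ :=
  Train 𝓧 L N × (ℕ → 𝓧)

/-- The family of tuples that are separated by some classifier of the family `G`. -/
def Psep {𝓧 : Type*} [MeasurableSpace 𝓧] {L : ℕ} (G : Set (𝓧 → Fin (L + 1))) :
    Set (Tuple 𝓧 L) :=
  {P | ∃ g ∈ G, ∀ θ m : Fin (L + 1), m ≠ θ →
    (P θ : Measure 𝓧) {x | g x = m} < (P θ : Measure 𝓧) {x | g x = θ}}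

/-- The law of the offline data: all samples independent, those with label `ϑ` drawn from `P_ϑ`. -/
def trainLaw {𝓧 : Type*} [MeasurableSpace 𝓧] {L : ℕ} (N : ℕ) (P : Tuple 𝓧 L) :
    Measure (Train 𝓧 L N) :=
  Measure.pi fun ϑ => Measure.pi fun _ : Fin N => (P ϑ : Measure 𝓧)

/-- The joint law of the offline data and of an independent i.i.d. test stream drawn from `P_θ`. -/
def law {𝓧 : Type*} [MeasurableSpace 𝓧] {L : ℕ} (N : ℕ) (P : Tuple 𝓧 L) (θ : Fin (L + 1)) :
    Measure (Sample 𝓧 L N) :=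
  (trainLaw N P).prod (Measure.infinitePi fun _ : ℕ => (P θ : Measure 𝓧))

/-- The information available at time `t` to a classifier-based test with learning policy `φ`: the
offline data `T` and the labels `g(X_1), …, g(X_t)`, where `g = φ(T)`. -/
def labelFiltration {𝓧 : Type*} [MeasurableSpace 𝓧] {L N : ℕ}
    (φ : Train 𝓧 L N → 𝓧 → Fin (L + 1))
    (hφ : Measurable fun p : Train 𝓧 L N × 𝓧 => φ p.1 p.2) :
    Filtration ℕ (inferInstance : MeasurableSpace (Sample 𝓧 L N)) where
  seq t := MeasurableSpace.comap
    (fun ω : Sample 𝓧 L N => (ω.1, fun s : Fin t => φ ω.1 (ω.2 s))) inferInstance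
  mono' := by
    intro t u htu
    have hm : Measurable fun q : Train 𝓧 L N × (Fin u → Fin (L + 1)) =>
        (q.1, fun s : Fin t => q.2 (Fin.castLE htu s)) := by fun_prop
    rintro A ⟨S, hS, rfl⟩
    exact ⟨_, hm hS, rfl⟩
  le' := by
    intro t
    refine Measurable.comap_le ?_
    refine measurable_fst.prodMk (measurable_pi_lambda _ fun s => ?_)
    exact hφ.comp (measurable_fst.prodMk ((measurable_pi_apply (s : ℕ)).comp measurable_snd))

/-- A classifier-based sequential test `π = (φ, τ)` with `N` training samples per label: a learning
policy with values in `G`, and a stopping time of the offline data and the predicted labels. -/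
structure Test {𝓧 : Type*} [MeasurableSpace 𝓧] {L : ℕ} (G : Set (𝓧 → Fin (L + 1))) (N : ℕ) where
  /-- the learning policy -/
  φ : Train 𝓧 L N → 𝓧 → Fin (L + 1)
  φ_mem : ∀ T, φ T ∈ G
  φ_measurable : Measurable fun p : Train 𝓧 L N × 𝓧 => φ p.1 p.2
  /-- the stopping time; `⊤` means that the test never stops -/
  τ : Sample 𝓧 L N → WithTop ℕ
  isStoppingTime : IsStoppingTime (labelFiltration φ φ_measurable) τ

/-- The tests that are level-`α` and power-one uniformly over `Psep G`. -/
def uniformTests {𝓧 : Type*} [MeasurableSpace 𝓧] {L : ℕ} (G : Set (𝓧 → Fin (L + 1))) (N : ℕ)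
    (α : ℝ) : Set (Test G N) :=
  {π | (⨆ P ∈ Psep G, law N P 0 {ω | π.τ ω < ⊤}) ≤ ENNReal.ofReal α ∧
    ∀ θ : Fin (L + 1), θ ≠ 0 → (⨅ P ∈ Psep G, law N P θ {ω | π.τ ω < ⊤}) = 1}

/-- The minimax tail probability at time `n` for the alternative `θ`
(an infimum in `[0, ∞]`, so it is `∞` if there is no test to choose from). -/
def minimaxTail {𝓧 : Type*} [MeasurableSpace 𝓧] {L : ℕ} (G : Set (𝓧 → Fin (L + 1))) (N : ℕ)
    (α : ℝ) (θ : Fin (L + 1)) (n : ℕ) : ℝ≥0∞ :=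
  ⨅ π ∈ uniformTests G N α, ⨆ P ∈ Psep G, law N P θ {ω | (n : WithTop ℕ) < π.τ ω}

/-- `D(p_0^g ‖ p_θ^g)`, where `p_m^g` is the law of `g(X)` for `X ∼ P_m`. -/
def labelKL {𝓧 : Type*} [MeasurableSpace 𝓧] {L : ℕ} (g : 𝓧 → Fin (L + 1)) (P : Tuple 𝓧 L)
    (θ : Fin (L + 1)) : ℝ≥0∞ :=
  InformationTheory.klDiv ((P 0 : Measure 𝓧).map g) ((P θ : Measure 𝓧).map g)

/-- The best label divergence achievable in the family `G`. -/
def bestKL {𝓧 : Type*} [MeasurableSpace 𝓧] {L : ℕ} (G : Set (𝓧 → Fin (L + 1))) (P : Tuple 𝓧 L)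
    (θ : Fin (L + 1)) : ℝ≥0∞ :=
  ⨆ g ∈ G, labelKL g P θ

/-- The suboptimality gap of `g` (nonnegative, as `labelKL g P θ ≤ bestKL G P θ` for `g ∈ G`). -/
def gap {𝓧 : Type*} [MeasurableSpace 𝓧] {L : ℕ} (G : Set (𝓧 → Fin (L + 1)))
    (g : 𝓧 → Fin (L + 1)) (P : Tuple 𝓧 L) (θ : Fin (L + 1)) : ℝ≥0∞ :=
  bestKL G P θ - labelKL g P θ

/-- The minimum aggregate suboptimality gap over two environments. -/
def aggregateGap {𝓧 : Type*} [MeasurableSpace 𝓧] {L : ℕ} (G : Set (𝓧 → Fin (L + 1)))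
    (P Q : Tuple 𝓧 L) (θ : Fin (L + 1)) : ℝ≥0∞ :=
  ⨅ g ∈ G, (gap G g P θ + gap G g Q θ)

end

end SeqTest

/-! Two change-of-measure arguments are combined. Given the offline data `T`, the event `τ > n`
depends only on `n` i.i.d. labels, whose laws under `0` and `θ` have divergence at most `n` times
that of `φ T`. The level constraint gives the event probability at least `1 - α` under `0`, so
Donsker–Varadhan forces its probability under `θ` to be at least `exp (-(n * d + log 2) / (1 - α))`,
with `d` the label divergence averaged over `T` (`tail_mul_neg_log_le`, `tail_bound_of_klDiv_le`).

The averages `d` cannot be near-optimal in both environments: each classifier loses at least `B` in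
total, and the two training laws have divergence at most `N * (L + 1) * M * δ ^ 2`.
Bretagnolle–Huber, as in Le Cam's two-point method, bounds the sum of the two expected losses below
by `B / 2` times the exponential of minus that quantity (`integral_labelKL_add_le`). Averaging the
two tail bounds halves this to `B / 4`. -/

namespace SeqTest

/-! ### Tensorization of the divergence, Donsker–Varadhan and Bretagnolle–Huber. -/

section Divergence

open InformationTheory

/-- The chain rule leaves a conditional term with common first marginal `μ`; swapping the factors
turns it into a common constant kernel, which contributes nothing. -/
theorem klDiv_prod_le {α β : Type*} [MeasurableSpace α] [MeasurableSpace β]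
    (μ ν : Measure α) (μ' ν' : Measure β) [IsProbabilityMeasure μ] [IsProbabilityMeasure ν]
    [IsProbabilityMeasure μ'] [IsProbabilityMeasure ν'] :
    klDiv (μ.prod μ') (ν.prod ν') ≤ klDiv μ ν + klDiv μ' ν' := by
  rw [← Measure.compProd_const, ← Measure.compProd_const, klDiv_compProd_eq_add]
  gcongr
  rw [Measure.compProd_const, Measure.compProd_const, ← Measure.prod_swap (μ := μ') (ν := μ),
    ← Measure.prod_swap (μ := ν') (ν := μ)]
  refine (klDiv_map_le _ _ measurable_swap).trans ?_
  rw [← Measure.compProd_const, ← Measure.compProd_const, klDiv_compProd_left]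

theorem klDiv_pi_le {α : Type*} [MeasurableSpace α] {k : ℕ} (μ ν : Fin k → Measure α)
    [∀ i, IsProbabilityMeasure (μ i)] [∀ i, IsProbabilityMeasure (ν i)] :
    klDiv (Measure.pi μ) (Measure.pi ν) ≤ ∑ i, klDiv (μ i) (ν i) := by
  induction k with
  | zero =>
    have h : Measure.pi μ = Measure.pi ν := by
      rw [Measure.pi_of_empty, Measure.pi_of_empty]
    rw [h, klDiv_self]
    exact zero_le
  | succ k ih =>
    have h (ρ : Fin (k + 1) → Measure α) [∀ i, IsProbabilityMeasure (ρ i)] :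
        Measure.pi ρ = ((ρ 0).prod (Measure.pi fun j => ρ ((0 : Fin (k + 1)).succAbove j))).map
          (MeasurableEquiv.piFinSuccAbove (fun _ => α) 0).symm :=
      (measurePreserving_piFinSuccAbove ρ 0).symm.map_eq.symm
    rw [h μ, h ν, Fin.sum_univ_succ]
    refine (klDiv_map_le _ _ (MeasurableEquiv.measurable _)).trans
      ((klDiv_prod_le _ _ _ _).trans ?_)
    gcongr
    exact ih _ _

/-- Fenchel–Young: `f ↦ exp f - 1` is the convex conjugate of `klFun`. For `r > 0` it is the tangent
inequality for `exp` at `log r`. -/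
theorem young_klFun {r : ℝ} (hr : 0 ≤ r) (f : ℝ) :
    r * f ≤ klFun r + (Real.exp f - 1) := by
  rcases hr.eq_or_lt with rfl | hr
  · simp [klFun_zero, Real.exp_nonneg]
  · have h := Real.add_one_le_exp (f - Real.log r)
    rw [Real.exp_sub, Real.exp_log hr, le_div_iff₀ hr] at h
    rw [klFun_apply]
    linarith

theorem integrable_klFun_of_klDiv_ne_top {α : Type*} [MeasurableSpace α] {μ ν : Measure α}
    [IsProbabilityMeasure μ] [IsProbabilityMeasure ν] (h : klDiv μ ν ≠ ∞) :
    Integrable (fun x => klFun (μ.rnDeriv ν x).toReal) ν := by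
  obtain ⟨hac, hint⟩ := klDiv_ne_top_iff.1 h
  exact (integrable_klFun_rnDeriv_iff hac).2 hint

/-- A form of the Donsker–Varadhan bound for the indicator of an event, with the logarithm of the
exponential moment replaced by its tangent at `2`. -/
theorem real_mul_neg_log_le_klDiv {α : Type*} [MeasurableSpace α] {μ ν : Measure α}
    [IsProbabilityMeasure μ] [IsProbabilityMeasure ν] (h : klDiv μ ν ≠ ∞)
    {E : Set α} (hE : MeasurableSet E) {q : ℝ} (hq : 0 < q) :
    μ.real E * (-Real.log q) ≤ (klDiv μ ν).toReal + Real.log 2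
      + ((ν.real E / q + (1 - ν.real E)) / 2 - 1) := by
  have hac := (klDiv_ne_top_iff.1 h).1
  have hK := integrable_klFun_of_klDiv_ne_top h
  set f : α → ℝ := E.indicator (fun _ => -Real.log q) with hf
  have hfint (ρ : Measure α) [IsProbabilityMeasure ρ] : Integrable f ρ :=
    (integrable_const _).indicator hE
  have hfi (c : ℝ) (ρ : Measure α) [IsProbabilityMeasure ρ] :
      Integrable (E.indicator (fun _ => c)) ρ := (integrable_const _).indicator hE
  -- Shifting `f` by `log 2` halves `exp f`; this is what replaces the logarithm of the moment by
  -- its tangent at `2`.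
  have hpt (x : α) : (μ.rnDeriv ν x).toReal • (f x - Real.log 2) ≤
      klFun (μ.rnDeriv ν x).toReal +
        ((E.indicator (fun _ => q⁻¹ / 2) x + Eᶜ.indicator (fun _ => (1 : ℝ) / 2) x) - 1) := by
    have h1 := young_klFun (ENNReal.toReal_nonneg (a := μ.rnDeriv ν x)) (f x - Real.log 2)
    have h2 : Real.exp (f x - Real.log 2) =
        E.indicator (fun _ => q⁻¹ / 2) x + Eᶜ.indicator (fun _ => (1 : ℝ) / 2) x := by
      rw [Real.exp_sub, Real.exp_log two_pos]
      by_cases hx : x ∈ E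
      · simp [hf, hx, Real.exp_neg, Real.exp_log hq]
      · simp [hf, hx]
    rwa [h2] at h1
  have hl : Integrable (fun x => f x - Real.log 2) μ := (hfint μ).sub (integrable_const _)
  have hi : Integrable (fun x => (E.indicator (fun _ => q⁻¹ / 2) x
      + Eᶜ.indicator (fun _ => (1 : ℝ) / 2) x)) ν :=
    ((integrable_const _).indicator hE).add ((integrable_const _).indicator hE.compl)
  have hi' := hi.sub (integrable_const (1 : ℝ))
  have key := integral_mono ((integrable_rnDeriv_smul_iff hac).2 hl) (hK.add hi') hpt
  rw [integral_rnDeriv_smul hac, integral_sub (hfint μ) (integrable_const _),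
    integral_add' hK hi', ← toReal_klDiv_eq_integral_klFun hac,
    integral_sub' hi (integrable_const _),
    integral_add ((integrable_const _).indicator hE) ((integrable_const _).indicator hE.compl),
    hf, integral_indicator_const _ hE, integral_indicator_const _ hE,
    integral_indicator_const _ hE.compl, probReal_compl_eq_one_sub hE] at key
  simp only [integral_const, probReal_univ, smul_eq_mul, one_mul] at key
  have : ν.real E / q = ν.real E * q⁻¹ := div_eq_mul_inv _ _
  rw [this]
  linarith

/-- Pointwise form of Bretagnolle–Huber. Here `klFun r + r - 1 = r log r`, so for a density `r` with
divergence `K` the left side integrates to `exp (-K) / 2`. -/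
theorem le_min_one_of_klFun {r : ℝ} (hr : 0 ≤ r) (K : ℝ) :
    Real.exp (-K) * (r * (1 + K / 2) - (klFun r + r - 1) / 2 - (r + 1) / 4) ≤ min r 1 := by
  set c := Real.exp (-K / 2) with hc
  have hc0 : 0 < c := Real.exp_pos _
  have hcc : Real.exp (-K) = c ^ 2 := by
    rw [hc, sq, ← Real.exp_add]
    ring_nf
  -- Jensen's bound on the Hellinger affinity `∫ √r ≥ exp (-K / 2)`, linearized by a tangent to
  -- `exp`.
  have hs : c * (r * (1 + K / 2) - (klFun r + r - 1) / 2) ≤ Real.sqrt r := by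
    rcases hr.eq_or_lt with rfl | hr
    · simp [klFun_zero]
    · have h1 := Real.add_one_le_exp ((K - Real.log r) / 2)
      have h2 : c * Real.exp ((K - Real.log r) / 2) * r = Real.sqrt r := by
        have h3 : Real.sqrt r = Real.exp (Real.log r / 2) := by
          rw [Real.exp_half, Real.exp_log hr]
        have h4 : r = Real.exp (Real.log r) := (Real.exp_log hr).symm
        rw [h3, hc]
        conv_lhs => rw [← Real.exp_add, h4, Real.log_exp, ← Real.exp_add]
        ring_nf
      calc c * (r * (1 + K / 2) - (klFun r + r - 1) / 2)
          = c * ((K - Real.log r) / 2 + 1) * r := by rw [klFun_apply]; ring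
        _ ≤ c * Real.exp ((K - Real.log r) / 2) * r := by gcongr
        _ = Real.sqrt r := h2
  have hm : 0 ≤ min r 1 := le_min hr zero_le_one
  have hmm : min r 1 * (r + 1 - min r 1) = r := by
    rcases le_total r 1 with h | h
    · rw [min_eq_left h]; ring
    · rw [min_eq_right h]; ring
  -- AM–GM in place of Cauchy–Schwarz: `r + 1 - min r 1` is `max r 1`, and `r` is the product of the
  -- minimum and the maximum.
  have hamgm : c * Real.sqrt r ≤ min r 1 + c ^ 2 * (r + 1 - min r 1) / 4 := by
    have hM : 0 ≤ r + 1 - min r 1 := by linarith [min_le_left r 1]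
    have : Real.sqrt r = Real.sqrt (min r 1) * Real.sqrt (r + 1 - min r 1) := by
      rw [← Real.sqrt_mul hm, hmm]
    rw [this]
    nlinarith [sq_nonneg (Real.sqrt (min r 1) - c * Real.sqrt (r + 1 - min r 1) / 2),
      Real.sq_sqrt hm, Real.sq_sqrt hM]
  have h5 := mul_le_mul_of_nonneg_left hs hc0.le
  rw [hcc]
  nlinarith [mul_nonneg (sq_nonneg c) hm]

/-- The Bretagnolle–Huber inequality, for the sum of the risks of two bounded losses. -/
theorem bretagnolle_huber {α : Type*} [MeasurableSpace α] {μ ν : Measure α}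
    [IsProbabilityMeasure μ] [IsProbabilityMeasure ν] (h : klDiv μ ν ≠ ∞)
    {f g : α → ℝ} (hf : ∀ x, 0 ≤ f x) (hg : ∀ x, 0 ≤ g x) {B : ℝ} (hB : 0 ≤ B)
    (hfg : ∀ x, B ≤ f x + g x) (hfi : Integrable f μ) (hgi : Integrable g ν) :
    B / 2 * Real.exp (-(klDiv μ ν).toReal) ≤ ∫ x, f x ∂μ + ∫ x, g x ∂ν := by
  have hac := (klDiv_ne_top_iff.1 h).1
  have hK := integrable_klFun_of_klDiv_ne_top h
  set K := (klDiv μ ν).toReal with hKdef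
  have hr : Integrable (fun x => (μ.rnDeriv ν x).toReal) ν := Measure.integrable_toReal_rnDeriv
  have hpt (x : α) : B * (Real.exp (-K) * ((μ.rnDeriv ν x).toReal * (1 / 4 + K / 2)
      - klFun (μ.rnDeriv ν x).toReal / 2 + 1 / 4)) ≤ (μ.rnDeriv ν x).toReal • f x + g x := by
    have hr0 : 0 ≤ (μ.rnDeriv ν x).toReal := ENNReal.toReal_nonneg
    set r := (μ.rnDeriv ν x).toReal
    have h1 := mul_le_mul_of_nonneg_left (le_min_one_of_klFun hr0 K) hB
    calc _ = B * (Real.exp (-K) * (r * (1 + K / 2) - (klFun r + r - 1) / 2 - (r + 1) / 4)) := by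
            ring
      _ ≤ B * min r 1 := h1
      _ ≤ (f x + g x) * min r 1 := by
        gcongr
        exact hfg x
      _ = f x * min r 1 + g x * min r 1 := by ring
      _ ≤ f x * r + g x * 1 := by
        gcongr
        · exact hf x
        · exact min_le_left _ _
        · exact hg x
        · exact min_le_right _ _
      _ = r • f x + g x := by simp [mul_comm]
  have hfi' := (integrable_rnDeriv_smul_iff hac).2 hfi
  have h1 : Integrable (fun x => (μ.rnDeriv ν x).toReal * (1 / 4 + K / 2)) ν := hr.mul_const _
  have h2 : Integrable (fun x => klFun (μ.rnDeriv ν x).toReal / 2) ν := hK.div_const _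
  have h3 : Integrable (fun _ : α => (1 / 4 : ℝ)) ν := integrable_const _
  have key := integral_mono ((((h1.sub h2).add h3).const_mul (Real.exp (-K))).const_mul B)
    (hfi'.add hgi) hpt
  rw [integral_const_mul, integral_const_mul, integral_add' (h1.sub h2) h3, integral_sub' h1 h2,
    integral_mul_const, integral_div, ← toReal_klDiv_eq_integral_klFun hac, ← hKdef,
    Measure.integral_toReal_rnDeriv hac, integral_add' hfi' hgi, integral_rnDeriv_smul hac] at key
  simp only [integral_const, probReal_univ, smul_eq_mul, one_mul] at key
  linarith

theorem klDiv_eq_sum {α : Type*} [MeasurableSpace α] [Fintype α] [MeasurableSingletonClass α]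
    {μ ν : Measure α} [IsProbabilityMeasure μ] [IsProbabilityMeasure ν] (h : μ ≪ ν) :
    klDiv μ ν = ∑ a, ENNReal.ofReal (klFun (μ {a} / ν {a}).toReal) * ν {a} := by
  rw [klDiv_eq_lintegral_klFun_of_ac h, lintegral_fintype]
  refine Finset.sum_congr rfl fun a _ => ?_
  rcases eq_or_ne (ν {a}) 0 with h0 | h0
  · simp [h0]
  · have h1 : μ {a} = μ.rnDeriv ν a * ν {a} := by
      conv_lhs => rw [← Measure.setLIntegral_rnDeriv h]
      rw [lintegral_singleton]
    rw [h1, ENNReal.mul_div_cancel_right h0 (measure_ne_top _ _)]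

end Divergence

/-! ### Divergences of labels and of training laws. -/

section LabelDivergence

variable {𝓧 : Type*} [MeasurableSpace 𝓧] {L N : ℕ}

instance (P : Tuple 𝓧 L) : IsProbabilityMeasure (trainLaw N P) := by
  unfold trainLaw; infer_instance

instance (P : Tuple 𝓧 L) (θ : Fin (L + 1)) : IsProbabilityMeasure (law N P θ) := by
  unfold law; infer_instance

theorem measurable_policy_apply {φ : Train 𝓧 L N → 𝓧 → Fin (L + 1)}
    (hφ : Measurable fun p : Train 𝓧 L N × 𝓧 => φ p.1 p.2) (T : Train 𝓧 L N) :
    Measurable (φ T) :=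
  hφ.comp (measurable_const.prodMk measurable_id)

/-- The label alphabet is finite, so the divergence is a finite sum of measurable functions of point
masses, each measurable in `T` by Fubini. -/
theorem measurable_labelKL {φ : Train 𝓧 L N → 𝓧 → Fin (L + 1)}
    (hφ : Measurable fun p : Train 𝓧 L N × 𝓧 => φ p.1 p.2) {P : Tuple 𝓧 L} {θ : Fin (L + 1)}
    (hac : (P 0 : Measure 𝓧) ≪ (P θ : Measure 𝓧)) :
    Measurable fun T => labelKL (φ T) P θ := by
  have hmass (m a : Fin (L + 1)) : Measurable fun T => ((P m : Measure 𝓧).map (φ T)) {a} := by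
    have h := measurable_measure_prodMk_left (ν := (P m : Measure 𝓧))
      (hφ (measurableSet_singleton a))
    convert! h using 2 with T
    rw [Measure.map_apply (measurable_policy_apply hφ T) (measurableSet_singleton a)]
    rfl
  have hsum : (fun T => labelKL (φ T) P θ) = fun T => ∑ a,
      ENNReal.ofReal (InformationTheory.klFun
        (((P 0 : Measure 𝓧).map (φ T)) {a} / ((P θ : Measure 𝓧).map (φ T)) {a}).toReal)
        * ((P θ : Measure 𝓧).map (φ T)) {a} := by
    ext T
    have hT := measurable_policy_apply hφ T
    have := Measure.isProbabilityMeasure_map (μ := (P 0 : Measure 𝓧)) hT.aemeasurable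
    have := Measure.isProbabilityMeasure_map (μ := (P θ : Measure 𝓧)) hT.aemeasurable
    exact klDiv_eq_sum (hac.map hT)
  rw [hsum]
  exact Finset.measurable_sum _ fun a _ =>
    (InformationTheory.measurable_klFun.comp
      ((hmass 0 a).div (hmass θ a)).ennreal_toReal).ennreal_ofReal.mul (hmass θ a)

theorem labelKL_le_klDiv {g : 𝓧 → Fin (L + 1)} (hg : Measurable g) (P : Tuple 𝓧 L)
    (θ : Fin (L + 1)) :
    labelKL g P θ ≤ InformationTheory.klDiv (P 0 : Measure 𝓧) (P θ : Measure 𝓧) :=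
  InformationTheory.klDiv_map_le _ _ hg

theorem bestKL_le_klDiv {G : Set (𝓧 → Fin (L + 1))} (hG : ∀ g ∈ G, Measurable g)
    (P : Tuple 𝓧 L) (θ : Fin (L + 1)) :
    bestKL G P θ ≤ InformationTheory.klDiv (P 0 : Measure 𝓧) (P θ : Measure 𝓧) :=
  iSup₂_le fun g hg => labelKL_le_klDiv (hG g hg) P θ

theorem infinitePi_map_labels (μ : Measure 𝓧) [IsProbabilityMeasure μ] {β : Type*}
    [MeasurableSpace β] {g : 𝓧 → β} (hg : Measurable g) (n : ℕ) :
    (Measure.infinitePi fun _ : ℕ => μ).map (fun x (s : Fin n) => g (x s)) =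
      Measure.pi fun _ : Fin n => μ.map g := by
  have := Measure.isProbabilityMeasure_map (μ := μ) hg.aemeasurable
  symm
  refine Measure.pi_eq fun s hs => ?_
  have hm : Measurable fun (x : ℕ → 𝓧) (i : Fin n) => g (x i) := by fun_prop
  rw [Measure.map_apply hm (MeasurableSet.univ_pi hs)]
  let t : ℕ → Set 𝓧 := fun i => if h : i < n then g ⁻¹' s ⟨i, h⟩ else Set.univ
  have ht (i : Fin n) : t i = g ⁻¹' s i := by simp [t]
  have hpre : (fun (x : ℕ → 𝓧) (i : Fin n) => g (x i)) ⁻¹' Set.univ.pi s =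
      Set.pi (Finset.range n) t := by
    ext x
    simp only [Set.mem_preimage, Set.mem_pi, Set.mem_univ, true_implies, Finset.coe_range,
      Set.mem_Iio]
    constructor
    · intro h i hi
      have := h ⟨i, hi⟩
      rw [ht ⟨i, hi⟩]
      exact this
    · intro h i
      have := h i i.2
      rw [ht] at this
      exact this
  rw [hpre, Measure.infinitePi_pi, Finset.prod_range]
  · refine Finset.prod_congr rfl fun i _ => ?_
    rw [ht, Measure.map_apply hg (hs i)]
  · intro i hi
    have := ht ⟨i, Finset.mem_range.1 hi⟩
    simp only at this
    rw [this]
    exact hg (hs _)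

theorem klDiv_labels_le {g : 𝓧 → Fin (L + 1)} (hg : Measurable g) (P : Tuple 𝓧 L)
    (θ : Fin (L + 1)) (n : ℕ) :
    InformationTheory.klDiv (Measure.pi fun _ : Fin n => (P 0 : Measure 𝓧).map g)
      (Measure.pi fun _ : Fin n => (P θ : Measure 𝓧).map g) ≤ n * labelKL g P θ := by
  have := Measure.isProbabilityMeasure_map (μ := (P 0 : Measure 𝓧)) hg.aemeasurable
  have := Measure.isProbabilityMeasure_map (μ := (P θ : Measure 𝓧)) hg.aemeasurable
  refine (klDiv_pi_le _ _).trans ?_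
  simp [labelKL]

theorem klDiv_trainLaw_le (P Q : Tuple 𝓧 L) {C : ℝ}
    (h : ∀ i, InformationTheory.klDiv (P i : Measure 𝓧) (Q i : Measure 𝓧) ≤ ENNReal.ofReal C) :
    InformationTheory.klDiv (trainLaw N P) (trainLaw N Q)
      ≤ ENNReal.ofReal (N * (L + 1) * C) := by
  calc InformationTheory.klDiv (trainLaw N P) (trainLaw N Q)
      ≤ ∑ i, InformationTheory.klDiv (Measure.pi fun _ : Fin N => (P i : Measure 𝓧))
          (Measure.pi fun _ : Fin N => (Q i : Measure 𝓧)) := klDiv_pi_le _ _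
    _ ≤ ∑ i : Fin (L + 1), ∑ _j : Fin N,
          InformationTheory.klDiv (P i : Measure 𝓧) (Q i : Measure 𝓧) :=
        Finset.sum_le_sum fun i _ => klDiv_pi_le _ _
    _ ≤ ∑ _i : Fin (L + 1), ∑ _j : Fin N, ENNReal.ofReal C :=
        Finset.sum_le_sum fun i _ => Finset.sum_le_sum fun _ _ => h i
    _ = ENNReal.ofReal (N * (L + 1) * C) := by
        rw [ENNReal.ofReal_mul (by positivity), ENNReal.ofReal_mul (by positivity)]
        have : ENNReal.ofReal ((L : ℝ) + 1) = (L : ℝ≥0∞) + 1 := by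
          rw [ENNReal.ofReal_add (by positivity) zero_le_one]; simp
        rw [this]
        simp
        ring

end LabelDivergence

/-! ### Tail probabilities of a test and the two-environment trade-off. -/

section Tail

variable {𝓧 : Type*} [MeasurableSpace 𝓧] {L N : ℕ} {G : Set (𝓧 → Fin (L + 1))}

theorem exists_tail_eq_preimage (π : Test G N) (n : ℕ) :
    ∃ S : Set (Train 𝓧 L N × (Fin n → Fin (L + 1))), MeasurableSet S ∧
      {ω | (n : WithTop ℕ) < π.τ ω} = (fun ω => (ω.1, fun s : Fin n => π.φ ω.1 (ω.2 s))) ⁻¹' S := by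
  obtain ⟨S, hS, h⟩ := π.isStoppingTime n
  refine ⟨Sᶜ, hS.compl, ?_⟩
  rw [Set.preimage_compl, h]
  ext ω
  simp

theorem measurableSet_tail (π : Test G N) (n : ℕ) :
    MeasurableSet {ω | (n : WithTop ℕ) < π.τ ω} := by
  have h := (labelFiltration π.φ π.φ_measurable).le n _ (π.isStoppingTime n)
  convert! h.compl using 1
  ext ω
  simp

theorem real_prod_eq_integral {α β : Type*} [MeasurableSpace α] [MeasurableSpace β]
    (μ : Measure α) (ν : Measure β) [IsFiniteMeasure μ] [IsFiniteMeasure ν] {E : Set (α × β)}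
    (hE : MeasurableSet E) :
    (μ.prod ν).real E = ∫ x, ν.real (Prod.mk x ⁻¹' E) ∂μ := by
  rw [Measure.real, Measure.prod_apply hE]
  exact (integral_toReal (measurable_measure_prodMk_left hE).aemeasurable
    (ae_of_all _ fun _ => measure_lt_top _ _)).symm

theorem integrable_real_section {α β : Type*} [MeasurableSpace α] [MeasurableSpace β]
    (μ : Measure α) (ν : Measure β) [IsFiniteMeasure μ] [IsProbabilityMeasure ν] {E : Set (α × β)}
    (hE : MeasurableSet E) : Integrable (fun x => ν.real (Prod.mk x ⁻¹' E)) μ := by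
  refine Integrable.of_bound
    (measurable_measure_prodMk_left hE).ennreal_toReal.aestronglyMeasurable 1 ?_
  refine ae_of_all _ fun x => ?_
  rw [Real.norm_of_nonneg measureReal_nonneg]
  exact measureReal_le_one

/-- Donsker–Varadhan is applied for each `T` and then integrated. The tangent form matters: it is
affine in the conditional tail probability, so only the averaged bound by `q` is needed. The real
majorant `κ` lets `n = 0` be treated even when divergences are infinite. -/
theorem tail_mul_neg_log_le (π : Test G N) (P : Tuple 𝓧 L) (θ : Fin (L + 1)) (n : ℕ)
    {κ : Train 𝓧 L N → ℝ} (hκ0 : ∀ T, 0 ≤ κ T)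
    (hκ : ∀ T, n * labelKL (π.φ T) P θ ≤ ENNReal.ofReal (κ T))
    (hκi : Integrable κ (trainLaw N P)) {q : ℝ} (hq : 0 < q)
    (hqP : (law N P θ).real {ω | (n : WithTop ℕ) < π.τ ω} ≤ q) :
    (law N P 0).real {ω | (n : WithTop ℕ) < π.τ ω} * (-Real.log q)
      ≤ ∫ T, κ T ∂(trainLaw N P) + Real.log 2 := by
  have hE := measurableSet_tail π n
  obtain ⟨S, hS, hES⟩ := exists_tail_eq_preimage π n
  set E := {ω | (n : WithTop ℕ) < π.τ ω}
  let a (m : Fin (L + 1)) (T : Train 𝓧 L N) : ℝ :=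
    (Measure.infinitePi fun _ : ℕ => (P m : Measure 𝓧)).real (Prod.mk T ⁻¹' E)
  have ha (m : Fin (L + 1)) : (law N P m).real E = ∫ T, a m T ∂(trainLaw N P) :=
    real_prod_eq_integral _ _ hE
  have hai (m : Fin (L + 1)) : Integrable (a m) (trainLaw N P) :=
    integrable_real_section _ _ hE
  have haT (T : Train 𝓧 L N) (m : Fin (L + 1)) :
      a m T = (Measure.pi fun _ : Fin n => (P m : Measure 𝓧).map (π.φ T)).real
        (Prod.mk T ⁻¹' S) := by
    have hT := measurable_policy_apply π.φ_measurable T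
    have hm : Measurable fun (x : ℕ → 𝓧) (i : Fin n) => π.φ T (x i) := by fun_prop
    rw [← infinitePi_map_labels _ hT, map_measureReal_apply hm (measurable_prodMk_left hS)]
    simp only [a, hES]
    rfl
  have hpt (T : Train 𝓧 L N) : a 0 T * (-Real.log q) ≤
      κ T + (a θ T * ((q⁻¹ - 1) / 2) + (Real.log 2 - 1 / 2)) := by
    have hT := measurable_policy_apply π.φ_measurable T
    have := Measure.isProbabilityMeasure_map (μ := (P 0 : Measure 𝓧)) hT.aemeasurable
    have := Measure.isProbabilityMeasure_map (μ := (P θ : Measure 𝓧)) hT.aemeasurable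
    have hkl := (klDiv_labels_le hT P θ n).trans (hκ T)
    have h := real_mul_neg_log_le_klDiv (ne_top_of_le_ne_top ENNReal.ofReal_ne_top hkl)
      (measurable_prodMk_left (x := T) hS) hq
    have h' := ENNReal.toReal_le_of_le_ofReal (hκ0 T) hkl
    rw [haT, haT]
    rw [div_eq_mul_inv _ q] at h
    linarith
  have h1 : Integrable (fun T => a θ T * ((q⁻¹ - 1) / 2)) (trainLaw N P) := (hai θ).mul_const _
  have h2 : Integrable (fun _ : Train 𝓧 L N => Real.log 2 - 1 / 2) (trainLaw N P) :=
    integrable_const _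
  have key := integral_mono ((hai 0).mul_const _) (hκi.add (h1.add h2)) hpt
  rw [integral_mul_const, ← ha, integral_add' hκi (h1.add h2), integral_add' h1 h2,
    integral_mul_const, ← ha] at key
  simp only [integral_const, probReal_univ, smul_eq_mul, one_mul] at key
  -- With `p` the tail probability under `θ`, the leftover `(p / q - p - 1) / 2` is nonpositive.
  have h3 : (law N P θ).real E * q⁻¹ ≤ 1 := (div_le_one hq).2 hqP
  have h4 : 0 ≤ (law N P θ).real E := measureReal_nonneg
  linarith

theorem one_sub_le_tail {α : ℝ} (hα0 : 0 ≤ α) {π : Test G N} (hπ : π ∈ uniformTests G N α)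
    {P : Tuple 𝓧 L} (hP : P ∈ Psep G) (n : ℕ) :
    1 - α ≤ (law N P 0).real {ω | (n : WithTop ℕ) < π.τ ω} := by
  have h1 : law N P 0 {ω | π.τ ω < ⊤} ≤ ENNReal.ofReal α :=
    (le_iSup₂ (f := fun P (_ : P ∈ Psep G) => law N P 0 {ω | π.τ ω < ⊤}) P hP).trans hπ.1
  have h2 : (law N P 0).real {ω | (n : WithTop ℕ) < π.τ ω}ᶜ ≤ α := by
    refine ENNReal.toReal_le_of_le_ofReal hα0 ((measure_mono ?_).trans h1)
    intro ω hω
    simp only [Set.mem_compl_iff, Set.mem_ofPred_eq, not_lt] at hω ⊢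
    exact hω.trans_lt (WithTop.coe_lt_top n)
  rw [probReal_compl_eq_one_sub (measurableSet_tail π n)] at h2
  linarith

/-- Passes from real upper bounds `q > 0` on two tails to the infimum in `[0, ∞]`; with no
admissible test that infimum is `∞`. -/
theorem ofReal_exp_le_minimaxTail {α : ℝ} (hα1 : α < 1) {θ : Fin (L + 1)} {n : ℕ}
    {P Q : Tuple 𝓧 L} (hP : P ∈ Psep G) (hQ : Q ∈ Psep G) {S : ℝ}
    (h : ∀ π ∈ uniformTests G N α, ∀ q : ℝ, 0 < q → q ≤ 1 →
      (law N P θ).real {ω | (n : WithTop ℕ) < π.τ ω} ≤ q →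
      (law N Q θ).real {ω | (n : WithTop ℕ) < π.τ ω} ≤ q → (1 - α) * (-Real.log q) ≤ S) :
    ENNReal.ofReal (Real.exp (-(S / (1 - α)))) ≤ minimaxTail G N α θ n := by
  refine le_iInf₂ fun π hπ => ?_
  have hα : 0 < 1 - α := by linarith
  have hS : 0 ≤ S := by
    simpa using h π hπ 1 one_pos le_rfl measureReal_le_one measureReal_le_one
  set c := Real.exp (-(S / (1 - α))) with hc
  have hc1 : c ≤ 1 := Real.exp_le_one_iff.2 (neg_nonpos.2 (by positivity))
  have hc0 : 0 < c := Real.exp_pos _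
  by_contra! hlt
  set s := ⨆ P ∈ Psep G, law N P θ {ω | (n : WithTop ℕ) < π.τ ω}
  have hs (R : Tuple 𝓧 L) (hR : R ∈ Psep G) :
      (law N R θ).real {ω | (n : WithTop ℕ) < π.τ ω} ≤ max s.toReal (c / 2) :=
    (ENNReal.toReal_mono hlt.ne_top (le_iSup₂
      (f := fun P (_ : P ∈ Psep G) => law N P θ {ω | (n : WithTop ℕ) < π.τ ω}) R hR)).trans
      (le_max_left _ _)
  -- The floor `c / 2` keeps `q` positive if the supremum vanishes, while `q` stays strictly below
  -- `c`.
  have hq0 : 0 < max s.toReal (c / 2) := lt_max_of_lt_right (by positivity)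
  have hqc : max s.toReal (c / 2) < c :=
    max_lt ((ENNReal.lt_ofReal_iff_toReal_lt hlt.ne_top).1 hlt) (half_lt_self hc0)
  have h1 := h π hπ _ hq0 (hqc.le.trans hc1) (hs P hP) (hs Q hQ)
  have h2 := Real.log_lt_log hq0 hqc
  rw [hc, Real.log_exp] at h2
  rw [mul_comm, ← le_div_iff₀ hα] at h1
  linarith

theorem le_gap_toReal_add_gap_toReal {P Q : Tuple 𝓧 L} {θ : Fin (L + 1)}
    (hbP : bestKL G P θ ≠ ∞) (hbQ : bestKL G Q θ ≠ ∞) {B : ℝ}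
    (hcap : ENNReal.ofReal B < aggregateGap G P Q θ) {g : 𝓧 → Fin (L + 1)} (hg : g ∈ G) :
    B ≤ ((bestKL G P θ).toReal - (labelKL g P θ).toReal)
      + ((bestKL G Q θ).toReal - (labelKL g Q θ).toReal) := by
  have hle (R : Tuple 𝓧 L) : labelKL g R θ ≤ bestKL G R θ :=
    le_iSup₂ (f := fun g (_ : g ∈ G) => labelKL g R θ) g hg
  have h : ENNReal.ofReal B ≤ gap G g P θ + gap G g Q θ := hcap.le.trans (iInf₂_le g hg)
  unfold gap at h
  rw [← ENNReal.toReal_sub_of_le (hle P) hbP, ← ENNReal.toReal_sub_of_le (hle Q) hbQ,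
    ← ENNReal.toReal_add (ENNReal.sub_ne_top hbP) (ENNReal.sub_ne_top hbQ)]
  exact (ENNReal.ofReal_le_iff_le_toReal
    (ENNReal.add_ne_top.2 ⟨ENNReal.sub_ne_top hbP, ENNReal.sub_ne_top hbQ⟩)).1 h

theorem integrable_labelKL_toReal (π : Test G N) {P : Tuple 𝓧 L} {θ : Fin (L + 1)}
    (hD : InformationTheory.klDiv (P 0 : Measure 𝓧) (P θ : Measure 𝓧) ≠ ∞)
    (μ : Measure (Train 𝓧 L N)) [IsFiniteMeasure μ] :
    Integrable (fun T => (labelKL (π.φ T) P θ).toReal) μ := by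
  refine Integrable.of_bound (measurable_labelKL π.φ_measurable
    (InformationTheory.klDiv_ne_top_iff.1 hD).1).ennreal_toReal.aestronglyMeasurable
    (InformationTheory.klDiv (P 0 : Measure 𝓧) (P θ : Measure 𝓧)).toReal
    (ae_of_all _ fun T => ?_)
  rw [Real.norm_of_nonneg ENNReal.toReal_nonneg]
  exact ENNReal.toReal_mono hD
    (labelKL_le_klDiv (measurable_policy_apply π.φ_measurable T) P θ)

/-- No learning policy attains the best label divergence in both environments. -/
theorem integral_labelKL_add_le (hG : ∀ g ∈ G, Measurable g) (π : Test G N) {P Q : Tuple 𝓧 L}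
    {θ : Fin (L + 1)} {D C B : ℝ} (hB : 0 ≤ B) (hC : 0 ≤ C) (hD : 0 ≤ D)
    (hDP : InformationTheory.klDiv (P 0 : Measure 𝓧) (P θ : Measure 𝓧) ≤ ENNReal.ofReal D)
    (hDQ : InformationTheory.klDiv (Q 0 : Measure 𝓧) (Q θ : Measure 𝓧) ≤ ENNReal.ofReal D)
    (hKL : ∀ i, InformationTheory.klDiv (P i : Measure 𝓧) (Q i : Measure 𝓧) ≤ ENNReal.ofReal C)
    (hcap : ENNReal.ofReal B < aggregateGap G P Q θ) :
    ∫ T, (labelKL (π.φ T) P θ).toReal ∂(trainLaw N P)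
      + ∫ T, (labelKL (π.φ T) Q θ).toReal ∂(trainLaw N Q)
      ≤ 2 * D - B / 2 * Real.exp (-(N * (L + 1) * C)) := by
  have hfin {R : Tuple 𝓧 L}
      (hR : InformationTheory.klDiv (R 0 : Measure 𝓧) (R θ : Measure 𝓧) ≤ ENNReal.ofReal D) :
      InformationTheory.klDiv (R 0 : Measure 𝓧) (R θ : Measure 𝓧) ≠ ∞ :=
    ne_top_of_le_ne_top ENNReal.ofReal_ne_top hR
  have hb {R : Tuple 𝓧 L}
      (hR : InformationTheory.klDiv (R 0 : Measure 𝓧) (R θ : Measure 𝓧) ≤ ENNReal.ofReal D) :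
      bestKL G R θ ≠ ∞ := ne_top_of_le_ne_top (hfin hR) (bestKL_le_klDiv hG R θ)
  have hbD {R : Tuple 𝓧 L}
      (hR : InformationTheory.klDiv (R 0 : Measure 𝓧) (R θ : Measure 𝓧) ≤ ENNReal.ofReal D) :
      (bestKL G R θ).toReal ≤ D :=
    ENNReal.toReal_le_of_le_ofReal hD ((bestKL_le_klDiv hG R θ).trans hR)
  have hnn {R : Tuple 𝓧 L}
      (hR : InformationTheory.klDiv (R 0 : Measure 𝓧) (R θ : Measure 𝓧) ≤ ENNReal.ofReal D)
      (T : Train 𝓧 L N) : 0 ≤ (bestKL G R θ).toReal - (labelKL (π.φ T) R θ).toReal :=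
    sub_nonneg.2 (ENNReal.toReal_mono (hb hR)
      (le_iSup₂ (f := fun g (_ : g ∈ G) => labelKL g R θ) (π.φ T) (π.φ_mem T)))
  have hC' : 0 ≤ N * (L + 1) * C := by positivity
  have htrain := klDiv_trainLaw_le (N := N) P Q hKL
  have hP := integrable_labelKL_toReal π (hfin hDP) (trainLaw N P)
  have hQ := integrable_labelKL_toReal π (hfin hDQ) (trainLaw N Q)
  -- The losses are the suboptimality gaps of `φ T` in the two environments, whose sum is at least
  -- `B` for every `T`.
  have key := bretagnolle_huber (ne_top_of_le_ne_top ENNReal.ofReal_ne_top htrain)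
    (hnn hDP) (hnn hDQ) hB
    (fun T => le_gap_toReal_add_gap_toReal (hb hDP) (hb hDQ) hcap (π.φ_mem T))
    ((integrable_const _).sub hP) ((integrable_const _).sub hQ)
  rw [integral_sub (integrable_const _) hP, integral_sub (integrable_const _) hQ] at key
  simp only [integral_const, probReal_univ, smul_eq_mul, one_mul] at key
  have hexp : B / 2 * Real.exp (-(N * (L + 1) * C)) ≤ B / 2 * Real.exp
      (-(InformationTheory.klDiv (trainLaw N P) (trainLaw N Q)).toReal) := by
    gcongr
    exact ENNReal.toReal_le_of_le_ofReal hC' htrain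
  linarith [hbD hDP, hbD hDQ]

theorem tail_bound_of_klDiv_le (π : Test G N) {P : Tuple 𝓧 L} {θ : Fin (L + 1)} {α : ℝ}
    (hα0 : 0 ≤ α) (hπ : π ∈ uniformTests G N α) (hP : P ∈ Psep G)
    (hD : InformationTheory.klDiv (P 0 : Measure 𝓧) (P θ : Measure 𝓧) ≠ ∞) (n : ℕ) {q : ℝ}
    (hq0 : 0 < q) (hq1 : q ≤ 1) (hqP : (law N P θ).real {ω | (n : WithTop ℕ) < π.τ ω} ≤ q) :
    (1 - α) * (-Real.log q)
      ≤ n * ∫ T, (labelKL (π.φ T) P θ).toReal ∂(trainLaw N P) + Real.log 2 := by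
  have hint := integrable_labelKL_toReal π hD (trainLaw N P)
  have h := tail_mul_neg_log_le π P θ n (κ := fun T => n * (labelKL (π.φ T) P θ).toReal)
    (fun T => by positivity) (fun T => ?_) (hint.const_mul _) hq0 hqP
  · rw [integral_const_mul] at h
    refine le_trans ?_ h
    gcongr
    · exact neg_nonneg.2 (Real.log_nonpos hq0.le hq1)
    · exact one_sub_le_tail hα0 hπ hP n
  · rw [ENNReal.ofReal_mul (by positivity), ENNReal.ofReal_natCast, ENNReal.ofReal_toReal]
    exact ne_top_of_le_ne_top hD
      (labelKL_le_klDiv (measurable_policy_apply π.φ_measurable T) P θ)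

end Tail

end SeqTest

/-! ### The minimax lower bound. -/

theorem theorem3 {𝓧 : Type*} [MeasurableSpace 𝓧] {L : ℕ} (hL : 1 ≤ L)
    (G : Set (𝓧 → Fin (L + 1))) (hG : ∀ g ∈ G, Measurable g)
    (N n : ℕ) (α : ℝ) (hα0 : 0 < α) (hα1 : α < 1)
    (P : ℝ → SeqTest.Tuple 𝓧 L) (ν₀ ν₁ δ : ℝ) (hδ : 0 < δ) (hν : ν₁ = ν₀ + δ)
    (hP₀ : P ν₀ ∈ SeqTest.Psep G) (hP₁ : P ν₁ ∈ SeqTest.Psep G)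
    (M : ℝ) (hM : 0 < M)
    (hKL : ∀ i : Fin (L + 1),
      InformationTheory.klDiv (P ν₀ i : Measure 𝓧) (P ν₁ i : Measure 𝓧)
        ≤ ENNReal.ofReal (M * δ ^ 2))
    (θ : Fin (L + 1)) (hθ : θ ≠ 0)
    (B : ℝ) (hB : 0 < B)
    (hcap : ENNReal.ofReal B < SeqTest.aggregateGap G (P ν₀) (P ν₁) θ) :
    -(((1 / (1 - α) : ℝ) : EReal) *
        ((n : EReal) *
            (((max (InformationTheory.klDiv (P ν₀ 0 : Measure 𝓧) (P ν₀ θ : Measure 𝓧))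
                (InformationTheory.klDiv (P ν₁ 0 : Measure 𝓧) (P ν₁ θ : Measure 𝓧)) : ℝ≥0∞) : EReal)
              - ((B / 4 * Real.exp (-(N * M * (L + 1) * δ ^ 2)) : ℝ) : EReal))
          + ((Real.log 2 : ℝ) : EReal)))
      ≤ ENNReal.log (SeqTest.minimaxTail G N α θ n) := by
  have hα : 0 < 1 - α := by linarith
  have conclude (S : ℝ) (hS : ENNReal.ofReal (Real.exp (-(S / (1 - α))))
      ≤ SeqTest.minimaxTail G N α θ n) :
      -(((1 / (1 - α) : ℝ) : EReal) * (S : EReal))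
        ≤ ENNReal.log (SeqTest.minimaxTail G N α θ n) := by
    refine le_trans (le_of_eq ?_) (ENNReal.log_monotone hS)
    rw [ENNReal.log_ofReal_of_pos (Real.exp_pos _), Real.log_exp, ← EReal.coe_mul,
      ← EReal.coe_neg]
    congr 1
    ring
  set K := max (InformationTheory.klDiv (P ν₀ 0 : Measure 𝓧) (P ν₀ θ : Measure 𝓧))
    (InformationTheory.klDiv (P ν₁ 0 : Measure 𝓧) (P ν₁ θ : Measure 𝓧)) with hK
  -- At `n = 0` the convention `0 * ∞ = 0` leaves a finite bound even if `K = ∞`; for `n > 0` and `K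
  -- = ∞` the claimed bound is `-∞`.
  rcases eq_or_ne n 0 with rfl | hn
  · rw [Nat.cast_zero, zero_mul, zero_add]
    refine conclude _ (SeqTest.ofReal_exp_le_minimaxTail hα1 hP₀ hP₁ ?_)
    intro π hπ q hq0 hq1 hq _
    have h := SeqTest.tail_mul_neg_log_le π (P ν₀) θ 0 (κ := 0) (fun _ => le_rfl)
      (fun T => by simp) (integrable_zero _ _ _) hq0 hq
    simp only [Pi.zero_apply, integral_zero, zero_add] at h
    refine le_trans ?_ h
    gcongr
    · exact neg_nonneg.2 (Real.log_nonpos hq0.le hq1)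
    · exact SeqTest.one_sub_le_tail hα0.le hπ hP₀ 0
  rcases eq_or_ne K ∞ with htop | hfin
  · rw [htop, EReal.coe_ennreal_top, EReal.top_sub_coe,
      EReal.mul_top_of_pos (by exact_mod_cast Nat.pos_of_ne_zero hn), EReal.top_add_coe,
      EReal.coe_mul_top_of_pos (by positivity), EReal.neg_top]
    exact bot_le
  · have hD₀ := le_max_left (InformationTheory.klDiv (P ν₀ 0 : Measure 𝓧) (P ν₀ θ : Measure 𝓧))
      (InformationTheory.klDiv (P ν₁ 0 : Measure 𝓧) (P ν₁ θ : Measure 𝓧))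
    have hD₁ := le_max_right (InformationTheory.klDiv (P ν₀ 0 : Measure 𝓧) (P ν₀ θ : Measure 𝓧))
      (InformationTheory.klDiv (P ν₁ 0 : Measure 𝓧) (P ν₁ θ : Measure 𝓧))
    rw [← hK] at hD₀ hD₁
    rw [← EReal.coe_ennreal_toReal hfin, ← EReal.coe_natCast, ← EReal.coe_sub, ← EReal.coe_mul,
      ← EReal.coe_add]
    refine conclude _ (SeqTest.ofReal_exp_le_minimaxTail hα1 hP₀ hP₁ ?_)
    intro π hπ q hq0 hq1 hq₀ hq₁
    have h₀ := SeqTest.tail_bound_of_klDiv_le π hα0.le hπ hP₀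
      (ne_top_of_le_ne_top hfin hD₀) n hq0 hq1 hq₀
    have h₁ := SeqTest.tail_bound_of_klDiv_le π hα0.le hπ hP₁
      (ne_top_of_le_ne_top hfin hD₁) n hq0 hq1 hq₁
    have hsum := SeqTest.integral_labelKL_add_le hG π hB.le (by positivity)
      ENNReal.toReal_nonneg (hD₀.trans (ENNReal.ofReal_toReal hfin).ge)
      (hD₁.trans (ENNReal.ofReal_toReal hfin).ge) hKL hcap
    have hexp : -((N : ℝ) * (L + 1) * (M * δ ^ 2)) = -(N * M * (L + 1) * δ ^ 2) := by ring
    rw [hexp] at hsum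
    -- The same `q` bounds both tails, so `h₀` and `h₁` are added and halved: `2 * D` becomes `D`,
    -- and `B / 2` becomes `B / 4`.
    have := mul_le_mul_of_nonneg_left hsum (Nat.cast_nonneg (α := ℝ) n)
    linarith
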